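/- Let $f\in\mathbb{R}[x_1,\dots,x_n]$ be called bounded if $f(x)\in[-1,1]$ for every $x\in\{-1,1\}^n$, and quartic if its degree is $4$. A $t$-query quantum algorithm $\mathcal{A}$ on inputs $x\in\{-1,1\}^n$ starts in a unit vector of a finite-dimensional space $\mathbb{C}^{n+1}\otimes\mathbb{C}^m$ ($m$ arbitrary), applies unitaries $U_0,\dots,U_t$ that do not depend on $x$, with one application of the oracle $O_x=\mathrm{diag}(x_1,\dots,x_n,1)\otimes I$ between any two consecutive ones, and finally performs a two-outcome measurement, which gives a random sign $\mathcal{A}(x)\in\{-1,1\}$ as the output. For every $C>0$ there exist an $n\in\mathbb{N}$ and a bounded quartic $n$-variable polynomial $f$ such that no two-query quantum algorithm $\mathcal{A}$ satisfies $\mathbb{E}[\mathcal{A}(x)]=C f(x)$ for every $x\in\{-1,1\}^n$. -/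

import Mathlib

open scoped ComplexOrder

/-- Evaluation of a real `n`-variable polynomial at a point of the hypercube `{-1,1}^n`.
The two-element type `ℤˣ = {1, -1}` is used for signs. -/
noncomputable def evalCube {n : ℕ} (f : MvPolynomial (Fin n) ℝ) (x : Fin n → ℤˣ) : ℝ :=
  MvPolynomial.eval (fun i => ((x i : ℤ) : ℝ)) f

/-- A polynomial is bounded if it maps the hypercube to `[-1,1]`. -/
def IsBoundedOnCube {n : ℕ} (f : MvPolynomial (Fin n) ℝ) : Prop :=
  ∀ x : Fin n → ℤˣ, evalCube f x ∈ Set.Icc (-1 : ℝ) 1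

/-- Computational basis of an algorithm's state space: a query register, holding either an
index `some i` or the idle symbol `none` (no query is made), and a workspace of dimension `m`. -/
abbrev QBasis (n m : ℕ) : Type := Option (Fin n) × Fin m

/-- The phase oracle of `x`: `|i, w⟩ ↦ x_i |i, w⟩` on indices and `|none, w⟩ ↦ |none, w⟩`.
It is the controlled phase query; the idle state plays the role of the control being off. -/
def phaseOracle {n : ℕ} (m : ℕ) (x : Fin n → ℤˣ) : Matrix (QBasis n m) (QBasis n m) ℂ :=
  Matrix.diagonal fun b => b.1.elim 1 fun i => ((x i : ℤ) : ℂ)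

/-- A `t`-query quantum algorithm with an `n`-bit input and a sign as output: a unit initial
state, `t + 1` input-independent unitaries, between which the `t` queries are made, and a final
two-outcome measurement (a POVM), all on a state space with a workspace of arbitrary finite
dimension. -/
structure QueryAlgorithm (n t : ℕ) where
  workDim : ℕ
  init : QBasis n workDim → ℂ
  init_unit : star init ⬝ᵥ init = 1
  unitary : Fin (t + 1) → Matrix.unitaryGroup (QBasis n workDim) ℂ
  measurement : ℤˣ → Matrix (QBasis n workDim) (QBasis n workDim) ℂ
  measurement_posSemidef : ∀ s, (measurement s).PosSemidef
  measurement_sum : ∑ s, measurement s = 1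

namespace QueryAlgorithm

variable {n t : ℕ}

/-- The state `U_t O_x U_{t-1} O_x ⋯ U_1 O_x U_0 |init⟩` just before the measurement. -/
def finalState (A : QueryAlgorithm n t) (x : Fin n → ℤˣ) : QBasis n A.workDim → ℂ :=
  Fin.induction (motive := fun _ => QBasis n A.workDim → ℂ)
    (Matrix.mulVec (A.unitary 0).1 A.init)
    (fun k ψ => Matrix.mulVec (A.unitary k.succ).1 (Matrix.mulVec (phaseOracle A.workDim x) ψ))
    (Fin.last t)

/-- The probability that the algorithm returns the sign `s` on input `x`. -/
def outputProb (A : QueryAlgorithm n t) (x : Fin n → ℤˣ) (s : ℤˣ) : ℝ :=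
  (star (A.finalState x) ⬝ᵥ Matrix.mulVec (A.measurement s) (A.finalState x)).re

/-- The expected output `𝔼[A(x)]` on input `x`. -/
def expectation (A : QueryAlgorithm n t) (x : Fin n → ℤˣ) : ℝ :=
  ∑ s : ℤˣ, ((s : ℤ) : ℝ) * A.outputProb x s

end QueryAlgorithm

/-!
A two-query algorithm has expected output `φ* D(x) A₁ D(x) A₂ D(x) A₃ D(x) φ`, with `D(x)` the
phase oracle, `φ` a unit vector and contractions `Aᵢ` that do not depend on `x`
(`QueryAlgorithm.exists_expectation_eq_fourForm`). Such an expression stays at most `1` in modulus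
when the signs on the diagonal of `D` are replaced by contractions on an auxiliary Hilbert space
(`norm_fourForm_le_one`). So the algorithms satisfy a von Neumann inequality in several variables,
and it is enough to find a bounded polynomial that violates this inequality by a large factor.

The violation is a construction of Varopoulos. For a finite abelian group `G` and signs `θ(g,h)`,
consider the cubic form `p(y) = ∑_{g+h+k=0} θ(g,h) y_{0,g} y_{1,h} y_{2,k}`. Any two of the
vertices `(0,g), (1,h), (2,k)` determine the third, so each slice of the coefficient tensor is a
matrix with entries `0, ±1` and at most one nonzero entry per row and column, hence a contraction.
Therefore the operators `varopoulosOp`, which raise the level in `ℂ ⊕ ℂ^V ⊕ ℂ^V ⊕ ℂ` and act by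
these slices in the middle, are contractions, and their products have as matrix elements exactly
the correlations of `p` with products of signs (`varopoulosOp_matrixElement`). Consequently
`𝔼 p(y) F(y) ≤ 1` for every function `F` computed by a two-query algorithm
(`expect_cubicForm_mul_expectation_le_one`), whereas `𝔼 p² = |G|²` by Parseval
(`expect_cubicForm_sq`).

For random signs, `|p| ≤ ε |G|²` on the whole cube once `|G| ≥ 6 / ε²`
(`exists_abs_cubicForm_le`). The quartic is `w · p(y) / (ε |G|²)` with one extra variable `w`. On
the inputs with `w = 1` it is the cubic `p / (ε |G|²)`, so if `C` times it is computed by an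
algorithm, then `C / ε ≤ 1`, which fails for `ε = C / 2`.
-/

/-! ### Contractions and the amplitudes of two-query algorithms -/

section Contraction

variable {B κ : Type*} [Fintype B] [Fintype κ]

/-- The matrix `A` does not increase the Euclidean norm. -/
def IsContraction (A : Matrix B B ℂ) : Prop :=
  ∀ v : B → ℂ, ∑ b, ‖A.mulVec v b‖ ^ 2 ≤ ∑ b, ‖v b‖ ^ 2

lemma star_dotProduct_self (v : B → ℂ) : star v ⬝ᵥ v = ((∑ b, ‖v b‖ ^ 2 : ℝ) : ℂ) := by
  simp only [dotProduct, Pi.star_apply, RCLike.star_def, Complex.conj_mul']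
  push_cast
  rfl

lemma IsContraction.of_conjTranspose_mul_self [DecidableEq B] {A : Matrix B B ℂ}
    (h : (1 - A.conjTranspose * A).PosSemidef) : IsContraction A := by
  intro v
  have h1 := h.dotProduct_mulVec_nonneg v
  have h2 : star v ⬝ᵥ (1 - A.conjTranspose * A).mulVec v
      = star v ⬝ᵥ v - star (A.mulVec v) ⬝ᵥ A.mulVec v := by
    rw [Matrix.sub_mulVec, Matrix.one_mulVec, dotProduct_sub, Matrix.star_mulVec,
      ← Matrix.dotProduct_mulVec, Matrix.mulVec_mulVec]
  rw [h2, star_dotProduct_self, star_dotProduct_self, ← Complex.ofReal_sub] at h1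
  have := Complex.zero_le_real.mp h1
  linarith

lemma IsContraction.of_mem_unitaryGroup [DecidableEq B] {U : Matrix B B ℂ}
    (hU : U ∈ Matrix.unitaryGroup B ℂ) : IsContraction U := by
  apply IsContraction.of_conjTranspose_mul_self
  have : U.conjTranspose * U = 1 := Matrix.mem_unitaryGroup_iff'.mp hU
  rw [this, sub_self]
  exact Matrix.PosSemidef.zero

lemma IsContraction.mul {A A' : Matrix B B ℂ} (h : IsContraction A) (h' : IsContraction A') :
    IsContraction (A * A') := by
  intro v
  rw [← Matrix.mulVec_mulVec]
  exact (h _).trans (h' v)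

/-- The observable of a two-outcome measurement is a contraction: with `P + Q = 1`, the
effects `P` and `Q` commute and `1 - (P - Q)² = 4 (P Q P + Q P Q)`. -/
lemma IsContraction.sub_of_add_eq_one [DecidableEq B] {P Q : Matrix B B ℂ} (hP : P.PosSemidef)
    (hQ : Q.PosSemidef) (h : P + Q = 1) : IsContraction (P - Q) := by
  apply IsContraction.of_conjTranspose_mul_self
  have h1 : (P * Q * P).PosSemidef := by
    have := hQ.mul_mul_conjTranspose_same P
    rwa [hP.1.eq] at this
  have h2 : (Q * P * Q).PosSemidef := by
    have := hP.mul_mul_conjTranspose_same Q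
    rwa [hQ.1.eq] at this
  have h3 : 1 - (P - Q).conjTranspose * (P - Q) =
      (P * Q * P + Q * P * Q) + (P * Q * P + Q * P * Q)
        + ((P * Q * P + Q * P * Q) + (P * Q * P + Q * P * Q)) := by
    rw [Matrix.conjTranspose_sub, hP.1.eq, hQ.1.eq, eq_sub_of_add_eq' h]
    noncomm_ring
  rw [h3]
  exact ((h1.add h2).add (h1.add h2)).add ((h1.add h2).add (h1.add h2))

/-- The four-linear form `∑ φ̄_a (A₁)_{ab} (A₂)_{bc} (A₃)_{cd} ψ_d Φ(a,b,c,d)`: the value of a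
two-query computation in which the product of the query answers at `a, b, c, d` is replaced
by `Φ a b c d`. -/
noncomputable def fourForm (φ ψ : B → ℂ) (A₁ A₂ A₃ : Matrix B B ℂ) (Φ : B → B → B → B → ℂ) : ℂ :=
  ∑ a, ∑ b, ∑ c, ∑ d, star (φ a) * A₁ a b * A₂ b c * A₃ c d * ψ d * Φ a b c d

lemma ofReal_mul_re_fourForm (r : ℝ) (φ ψ : B → ℂ) (A₁ A₂ A₃ : Matrix B B ℂ)
    (Φ : B → B → B → B → ℂ) : r * (fourForm φ ψ A₁ A₂ A₃ Φ).re =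
      (fourForm φ ψ A₁ A₂ A₃ fun a b c d => r * Φ a b c d).re := by
  rw [← Complex.re_ofReal_mul]
  simp only [fourForm, Finset.mul_sum]
  simp only [mul_left_comm (r : ℂ)]

open scoped BigOperators in
lemma expect_re_fourForm {Y : Type*} [Fintype Y] (φ ψ : B → ℂ) (A₁ A₂ A₃ : Matrix B B ℂ)
    (h : Y → B → B → B → B → ℝ) :
    𝔼 y, (fourForm φ ψ A₁ A₂ A₃ fun a b c d => (h y a b c d : ℂ)).re =
      (fourForm φ ψ A₁ A₂ A₃ fun a b c d => ((𝔼 y, h y a b c d : ℝ) : ℂ)).re := by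
  simp only [fourForm, Complex.re_sum, Complex.re_mul_ofReal, Finset.expect_sum_comm,
    Finset.mul_expect]

/-- A contraction on `ℂ^B` is still a contraction after tensoring with the identity of `ℂ^κ`. -/
lemma IsContraction.sum_smul_le {A : Matrix B B ℂ} (h : IsContraction A) (Ψ : B → κ → ℂ) :
    ∑ b, ∑ k, ‖(∑ b', A b b' • Ψ b') k‖ ^ 2 ≤ ∑ b, ∑ k, ‖Ψ b k‖ ^ 2 := by
  rw [Finset.sum_comm, Finset.sum_comm (s := Finset.univ (α := B))]
  refine Finset.sum_le_sum fun k _ => ?_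
  have := h (fun b => Ψ b k)
  simpa [Matrix.mulVec, dotProduct, Finset.sum_apply] using this

/-- If the query answers are replaced by contractions on an auxiliary space, then the
resulting amplitude is still at most `1`. -/
lemma norm_fourForm_le_one [DecidableEq κ] {φ ψ : B → ℂ} {A₁ A₂ A₃ : Matrix B B ℂ}
    (hφ : ∑ b, ‖φ b‖ ^ 2 ≤ 1) (hψ : ∑ b, ‖ψ b‖ ^ 2 ≤ 1)
    (h₁ : IsContraction A₁) (h₂ : IsContraction A₂) (h₃ : IsContraction A₃)
    (X : B → Module.End ℂ (κ → ℂ))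
    (hX : ∀ b (v : κ → ℂ), ∑ k, ‖X b v k‖ ^ 2 ≤ ∑ k, ‖v k‖ ^ 2) (e g : κ) :
    ‖fourForm φ ψ A₁ A₂ A₃ fun a b c d => X a (X b (X c (X d (Pi.single e 1)))) g‖ ≤ 1 := by
  set Ψ₀ : B → κ → ℂ := fun d => ψ d • Pi.single e 1 with hΨ₀
  set Ψ₁ : B → κ → ℂ := fun c => ∑ d, A₃ c d • X d (Ψ₀ d) with hΨ₁
  set Ψ₂ : B → κ → ℂ := fun b => ∑ c, A₂ b c • X c (Ψ₁ c) with hΨ₂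
  set Ψ₃ : B → κ → ℂ := fun a => ∑ b, A₁ a b • X b (Ψ₂ b) with hΨ₃
  have step : ∀ {A : Matrix B B ℂ} (_ : IsContraction A) (Ψ : B → κ → ℂ),
      ∑ a, ∑ k, ‖(∑ b, A a b • X b (Ψ b)) k‖ ^ 2 ≤ ∑ b, ∑ k, ‖Ψ b k‖ ^ 2 := fun hA Ψ =>
    (hA.sum_smul_le fun b => X b (Ψ b)).trans (Finset.sum_le_sum fun b _ => hX b _)
  have n₀ : ∑ b, ∑ k, ‖Ψ₀ b k‖ ^ 2 ≤ 1 := by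
    refine le_trans (le_of_eq ?_) hψ
    refine Finset.sum_congr rfl fun b _ => ?_
    rw [Finset.sum_eq_single e]
    · simp [hΨ₀]
    · intro k _ hk
      simp [hΨ₀, hk]
    · simp
  have n₃ : ∑ b, ∑ k, ‖Ψ₃ b k‖ ^ 2 ≤ 1 :=
    (step h₁ Ψ₂).trans <| (step h₂ Ψ₁).trans <| (step h₃ Ψ₀).trans n₀
  have n₄ : ∑ b, ‖X b (Ψ₃ b) g‖ ^ 2 ≤ 1 :=
    (Finset.sum_le_sum fun b _ =>
      (Finset.single_le_sum (f := fun k => ‖X b (Ψ₃ b) k‖ ^ 2) (fun _ _ => by positivity)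
        (Finset.mem_univ g)).trans (hX b _)).trans n₃
  have hval : fourForm φ ψ A₁ A₂ A₃ (fun a b c d => X a (X b (X c (X d (Pi.single e 1)))) g)
      = ∑ a, star (φ a) * X a (Ψ₃ a) g := by
    simp only [fourForm, hΨ₃, hΨ₂, hΨ₁, hΨ₀, map_sum, map_smul, Finset.smul_sum,
      Finset.sum_apply, Pi.smul_apply, smul_eq_mul, Finset.mul_sum]
    refine Finset.sum_congr rfl fun a _ => Finset.sum_congr rfl fun b _ =>
      Finset.sum_congr rfl fun c _ => Finset.sum_congr rfl fun d _ => ?_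
    ring
  rw [hval]
  calc ‖∑ a, star (φ a) * X a (Ψ₃ a) g‖
      ≤ ∑ a, ‖φ a‖ * ‖X a (Ψ₃ a) g‖ := by
        refine (norm_sum_le _ _).trans (le_of_eq ?_)
        simp
    _ ≤ ∑ a, (‖φ a‖ ^ 2 + ‖X a (Ψ₃ a) g‖ ^ 2) / 2 :=
        Finset.sum_le_sum fun a _ => by linarith [two_mul_le_add_sq ‖φ a‖ ‖X a (Ψ₃ a) g‖]
    _ ≤ 1 := by
        rw [← Finset.sum_div, Finset.sum_add_distrib]
        linarith

/-- A matrix with entries of modulus at most `1` and at most one nonzero entry in each row and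
in each column is a contraction. -/
lemma IsContraction.of_partialPerm {V : Type*} [Fintype V] {c : V → V → ℂ} (h1 : ∀ u v, ‖c u v‖ ≤ 1)
    (hrow : ∀ u v v', c u v ≠ 0 → c u v' ≠ 0 → v = v')
    (hcol : ∀ u u' v, c u v ≠ 0 → c u' v ≠ 0 → u = u') : IsContraction (Matrix.of c) := by
  intro ξ
  have hsq : ∀ u, ‖(Matrix.of c).mulVec ξ u‖ ^ 2 = ∑ v, ‖c u v‖ ^ 2 * ‖ξ v‖ ^ 2 := by
    intro u
    by_cases h : ∃ v, c u v ≠ 0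
    · obtain ⟨v, hv⟩ := h
      have h0 : ∀ v', v' ≠ v → c u v' = 0 := fun v' hne => by
        by_contra hc
        exact hne (hrow u v' v hc hv)
      simp only [Matrix.mulVec, dotProduct, Matrix.of_apply]
      rw [Finset.sum_eq_single v, Finset.sum_eq_single v, norm_mul, mul_pow]
      all_goals simp +contextual [h0]
    · push Not at h
      simp [Matrix.mulVec, dotProduct, h]
  simp only [hsq]
  rw [Finset.sum_comm]
  refine Finset.sum_le_sum fun v _ => ?_
  rw [← Finset.sum_mul]
  refine mul_le_of_le_one_left (by positivity) ?_
  by_cases h : ∃ u, c u v ≠ 0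
  · obtain ⟨u, hu⟩ := h
    rw [Finset.sum_eq_single u]
    · exact pow_le_one₀ (norm_nonneg _) (h1 u v)
    · intro u' _ hne
      have : c u' v = 0 := by
        by_contra hc
        exact hne (hcol u' u v hc hu)
      simp [this]
    · simp
  · push Not at h
    simp [h]

end Contraction

namespace QueryAlgorithm

/-- The answer of the phase oracle of `x` at a basis state. -/
def oracleSign {n m : ℕ} (x : Fin n → ℤˣ) (b : QBasis n m) : ℂ :=
  b.1.elim 1 fun i => ((x i : ℤ) : ℂ)

lemma star_oracleSign {n m : ℕ} (x : Fin n → ℤˣ) (b : QBasis n m) :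
    star (oracleSign x b) = oracleSign x b := by
  rcases b with ⟨_ | i, w⟩ <;> simp [oracleSign]

/-- The expected output of a two-query algorithm is `φ* D A₁ D A₂ D A₃ D φ`, where `D` is the
phase oracle, `φ` a unit vector and the `Aᵢ` are contractions that do not depend on the input. -/
lemma exists_expectation_eq_fourForm {n : ℕ} (A : QueryAlgorithm n 2) :
    ∃ (φ : QBasis n A.workDim → ℂ) (A₁ A₂ A₃ : Matrix (QBasis n A.workDim) (QBasis n A.workDim) ℂ),
      ∑ b, ‖φ b‖ ^ 2 ≤ 1 ∧ IsContraction A₁ ∧ IsContraction A₂ ∧ IsContraction A₃ ∧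
      ∀ x : Fin n → ℤˣ, A.expectation x = (fourForm φ φ A₁ A₂ A₃ fun a b c d =>
        oracleSign x a * oracleSign x b * oracleSign x c * oracleSign x d).re := by
  set U := A.unitary
  set M := A.measurement 1 - A.measurement (-1) with hM
  have huniv : (Finset.univ : Finset ℤˣ) = {1, -1} := by decide
  have hMc : IsContraction M := by
    refine IsContraction.sub_of_add_eq_one (A.measurement_posSemidef 1)
      (A.measurement_posSemidef (-1)) ?_
    rw [← A.measurement_sum, huniv, Finset.sum_pair (by decide)]
  have hU : ∀ i, IsContraction (U i).1 := fun i => .of_mem_unitaryGroup (U i).2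
  have hU' : ∀ i, IsContraction (U i).1.conjTranspose := fun i =>
    .of_mem_unitaryGroup (star (U i)).2
  refine ⟨(U 0).1.mulVec A.init, (U 1).1.conjTranspose,
    (U 2).1.conjTranspose * M * (U 2).1, (U 1).1, ?_, hU' 1, ((hU' 2).mul hMc).mul (hU 2), hU 1, ?_⟩
  · refine (hU 0 _).trans ?_
    have := A.init_unit
    rw [star_dotProduct_self] at this
    exact le_of_eq (by exact_mod_cast this)
  intro x
  set φ := (U 0).1.mulVec A.init
  set v : QBasis n A.workDim → ℂ := (phaseOracle A.workDim x).mulVec ((U 1).1.mulVec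
    ((phaseOracle A.workDim x).mulVec φ)) with hv
  have hfin : A.finalState x = (U 2).1.mulVec v := rfl
  have hexp : A.expectation x =
      (star v ⬝ᵥ ((U 2).1.conjTranspose * M * (U 2).1).mulVec v).re := by
    rw [expectation, huniv, Finset.sum_pair (by decide)]
    simp only [outputProb, hfin, hM]
    rw [Matrix.mul_assoc, ← Matrix.mulVec_mulVec, Matrix.dotProduct_mulVec (star v),
      ← Matrix.star_mulVec, ← Matrix.mulVec_mulVec, Matrix.sub_mulVec, dotProduct_sub,
      Complex.sub_re]
    simp [sub_eq_add_neg]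
  have hvb : ∀ b, v b = ∑ d, oracleSign x b * ((U 1).1 b d * (oracleSign x d * φ d)) := by
    intro b
    simp only [hv, phaseOracle, Matrix.mulVec_diagonal]
    rw [Matrix.mulVec, dotProduct, Finset.mul_sum]
    simp only [Matrix.mulVec_diagonal]
    rfl
  rw [hexp]
  congr 1
  rw [fourForm]
  simp only [dotProduct, Matrix.mulVec, Pi.star_apply, hvb, star_sum, star_mul',
    star_oracleSign, Matrix.conjTranspose_apply, Finset.sum_mul, Finset.mul_sum]
  conv_rhs => rw [Finset.sum_comm]
  refine Finset.sum_congr rfl fun b _ => ?_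
  conv_rhs => rw [Finset.sum_comm]
  refine Finset.sum_congr rfl fun c _ => ?_
  rw [Finset.sum_comm]
  refine Finset.sum_congr rfl fun a _ => Finset.sum_congr rfl fun d _ => ?_
  ring

end QueryAlgorithm

/-! ### Sign patterns with small correlations -/

section RandomSigns

variable {ι κ : Type*} [Fintype ι] [DecidableEq ι] [Fintype κ]

lemma sum_units_int {M : Type*} [AddCommMonoid M] (F : ℤˣ → M) : ∑ s, F s = F 1 + F (-1) := by
  have huniv : (Finset.univ : Finset ℤˣ) = {1, -1} := by decide
  rw [huniv, Finset.sum_pair (by decide)]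

lemma sum_exp_signs_le (t : ℝ) (a : ι → ℤˣ) :
    ∑ θ : ι → ℤˣ, Real.exp (t * ∑ i, ((θ i : ℤ) : ℝ) * ((a i : ℤ) : ℝ)) ≤
      2 ^ Fintype.card ι * Real.exp (t ^ 2 / 2 * Fintype.card ι) := by
  have h1 : ∀ i, ∑ s : ℤˣ, Real.exp (t * (((s : ℤ) : ℝ) * ((a i : ℤ) : ℝ))) ≤
      2 * Real.exp (t ^ 2 / 2) := by
    intro i
    have hc := Real.cosh_le_exp_half_sq t
    rw [Real.cosh_eq] at hc
    rw [sum_units_int]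
    rcases Int.units_eq_one_or (a i) with h | h <;> simp [h] <;> linarith
  calc ∑ θ : ι → ℤˣ, Real.exp (t * ∑ i, ((θ i : ℤ) : ℝ) * ((a i : ℤ) : ℝ))
      = ∑ θ : ι → ℤˣ, ∏ i, Real.exp (t * (((θ i : ℤ) : ℝ) * ((a i : ℤ) : ℝ))) := by
        simp only [Finset.mul_sum, Real.exp_sum]
    _ = ∏ i, ∑ s : ℤˣ, Real.exp (t * (((s : ℤ) : ℝ) * ((a i : ℤ) : ℝ))) :=
        by rw [Fintype.prod_sum]
    _ ≤ ∏ _i : ι, 2 * Real.exp (t ^ 2 / 2) :=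
        Finset.prod_le_prod (fun i _ => Finset.sum_nonneg fun _ _ => (Real.exp_pos _).le)
          fun i _ => h1 i
    _ = _ := by
        rw [Finset.prod_const, Finset.card_univ, mul_pow, ← Real.exp_nat_mul, mul_comm (t ^ 2 / 2)]

/-- Chernoff and a union bound: some choice of signs `θ` has correlation at most
`log |κ| / t + t |ι| / 2` with each of the `|κ|` sign vectors `a k`. -/
lemma exists_signs_forall_sum_le [Nonempty κ] {t : ℝ} (ht : 0 < t) (a : κ → ι → ℤˣ) :
    ∃ θ : ι → ℤˣ, ∀ k, ∑ i, ((θ i : ℤ) : ℝ) * ((a k i : ℤ) : ℝ) ≤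
      Real.log (Fintype.card κ) / t + t / 2 * Fintype.card ι := by
  have hcard : (0 : ℝ) < Fintype.card κ := by exact_mod_cast Fintype.card_pos
  obtain ⟨θ, -, hθ⟩ : ∃ θ ∈ (Finset.univ : Finset (ι → ℤˣ)),
      ∑ k, Real.exp (t * ∑ i, ((θ i : ℤ) : ℝ) * ((a k i : ℤ) : ℝ)) ≤
        Fintype.card κ * Real.exp (t ^ 2 / 2 * Fintype.card ι) := by
    apply Finset.exists_le_of_sum_le Finset.univ_nonempty
    rw [Finset.sum_comm]
    refine (Finset.sum_le_sum fun k _ => sum_exp_signs_le t (a k)).trans (le_of_eq ?_)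
    simp
    ring
  refine ⟨θ, fun k => ?_⟩
  have h1 := (Finset.single_le_sum
    (f := fun k => Real.exp (t * ∑ i, ((θ i : ℤ) : ℝ) * ((a k i : ℤ) : ℝ)))
    (fun _ _ => (Real.exp_pos _).le) (Finset.mem_univ k)).trans hθ
  have h2 := Real.log_le_log (Real.exp_pos _) h1
  rw [Real.log_exp, Real.log_mul hcard.ne' (Real.exp_pos _).ne', Real.log_exp] at h2
  have h3 : t * (Real.log (Fintype.card κ) / t + t / 2 * Fintype.card ι) =
      Real.log (Fintype.card κ) + t ^ 2 / 2 * Fintype.card ι := by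
    field_simp
  exact le_of_mul_le_mul_left (h2.trans_eq h3.symm) ht

end RandomSigns

/-! ### Fourier coefficients of a tripartite cubic form -/

section CubicForm

open scoped BigOperators

variable {V : Type*}

/-- The real value of a sign vector at an optional coordinate, with value `1` at `none`. -/
def signAt (y : V → ℤˣ) (a : Option V) : ℝ := a.elim 1 fun v => ((y v : ℤ) : ℝ)

@[simp] lemma signAt_none (y : V → ℤˣ) : signAt y none = 1 := rfl

lemma signAt_some (y : V → ℤˣ) (v : V) : signAt y (some v) = ((y v : ℤ) : ℝ) := rfl

lemma signAt_mul_self (y : V → ℤˣ) (a : Option V) : signAt y a * signAt y a = 1 := by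
  rcases a with _ | v
  · simp
  · rcases Int.units_eq_one_or (y v) with h | h <;> simp [signAt_some, h]

lemma signAt_neg_some (y : V → ℤˣ) (v : V) : signAt (-y) (some v) = -signAt y (some v) := by
  simp [signAt_some]

variable [DecidableEq V]

/-- Reversal of the sign of one coordinate. -/
def flipAt (v : V) (y : V → ℤˣ) : V → ℤˣ := Pi.mulSingle v (-1) * y

lemma signAt_flipAt_self (v : V) (y : V → ℤˣ) :
    signAt (flipAt v y) (some v) = -signAt y (some v) := by
  simp [signAt_some, flipAt]

lemma signAt_flipAt_of_ne {v : V} {a : Option V} (h : some v ≠ a) (y : V → ℤˣ) :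
    signAt (flipAt v y) a = signAt y a := by
  rcases a with _ | u
  · rfl
  · have : u ≠ v := fun e => h (by rw [e])
    simp [signAt_some, flipAt, this]

variable [Fintype V]

lemma expect_eq_zero_of_flipAt (v : V) {h : (V → ℤˣ) → ℝ} (hh : ∀ y, h (flipAt v y) = -h y) :
    𝔼 y, h y = 0 := by
  have h1 : 𝔼 y, h y = 𝔼 y, h (flipAt v y) :=
    (Fintype.expect_equiv (Equiv.mulLeft (Pi.mulSingle v (-1))) (fun y => h (flipAt v y)) h
      fun _ => rfl).symm
  simp only [hh, Finset.expect_neg_distrib] at h1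
  linarith

lemma expect_eq_zero_of_neg {h : (V → ℤˣ) → ℝ} (hh : ∀ y, h (-y) = -h y) :
    𝔼 y, h y = 0 := by
  have h1 : 𝔼 y, h y = 𝔼 y, h (-y) :=
    (Fintype.expect_equiv (Equiv.neg _) (fun y => h (-y)) h fun _ => rfl).symm
  simp only [hh, Finset.expect_neg_distrib] at h1
  linarith

variable {G : Type*} [AddCommGroup G]

/-- The signs `y_{0,g} y_{1,h} y_{2,k}` on the edge `{(0,g), (1,h), (2,k)}`, `g + h + k = 0`. -/
def edgeSign (y : Fin 3 × G → ℤˣ) (p : G × G) : ℤˣ :=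
  y (0, p.1) * y (1, p.2) * y (2, -(p.1 + p.2))

lemma edgeSign_cast (y : Fin 3 × G → ℤˣ) (p : G × G) : ((edgeSign y p : ℤ) : ℝ) =
    signAt y (some (0, p.1)) * signAt y (some (1, p.2)) * signAt y (some (2, -(p.1 + p.2))) := by
  simp [edgeSign, signAt_some]

lemma edgeSign_neg (y : Fin 3 × G → ℤˣ) (p : G × G) :
    ((edgeSign (-y) p : ℤ) : ℝ) = -((edgeSign y p : ℤ) : ℝ) := by
  simp only [edgeSign_cast, signAt_neg_some]
  ring

/-- The vertices of the edge `p` are among `a, u, v`. -/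
def IsEdge (p : G × G) (a u v : Option (Fin 3 × G)) : Prop :=
  ∀ w : Fin 3 × G, (w = (0, p.1) ∨ w = (1, p.2) ∨ w = (2, -(p.1 + p.2))) →
    some w = a ∨ some w = u ∨ some w = v

lemma isEdge_self (p : G × G) :
    IsEdge p (some (0, p.1)) (some (1, p.2)) (some (2, -(p.1 + p.2))) := by
  intro w hw
  simpa using hw

/-- Three vertices that contain an edge are its vertices, in some order. -/
lemma IsEdge.cases {p : G × G} {a u v : Option (Fin 3 × G)} (h : IsEdge p a u v) :
    let A := some ((0 : Fin 3), p.1); let B := some ((1 : Fin 3), p.2)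
    let C := some ((2 : Fin 3), -(p.1 + p.2))
    (a = A ∧ u = B ∧ v = C) ∨ (a = A ∧ u = C ∧ v = B) ∨ (a = B ∧ u = A ∧ v = C) ∨
    (a = B ∧ u = C ∧ v = A) ∨ (a = C ∧ u = A ∧ v = B) ∨ (a = C ∧ u = B ∧ v = A) := by
  intro A B C
  have h0 := h _ (Or.inl rfl)
  have h1 := h _ (Or.inr (Or.inl rfl))
  have h2 := h _ (Or.inr (Or.inr rfl))
  have hAB : A ≠ B := by simp [A, B]
  have hAC : A ≠ C := by simp [A, C]
  have hBC : B ≠ C := by simp [B, C]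
  change A = a ∨ A = u ∨ A = v at h0
  change B = a ∨ B = u ∨ B = v at h1
  change C = a ∨ C = u ∨ C = v at h2
  clear_value A B C
  grind

/-- An edge is determined by the set of its vertices. -/
lemma IsEdge.edge_unique {p q : G × G} {a u v : Option (Fin 3 × G)} (h : IsEdge p a u v)
    (h' : IsEdge q a u v) : p = q := by
  rcases p with ⟨g, k⟩
  rcases q with ⟨g', k'⟩
  rcases h.cases with h | h | h | h | h | h <;> rcases h'.cases with h' | h' | h' | h' | h' | h' <;>
    obtain ⟨rfl, rfl, rfl⟩ := h <;> simp_all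

/-- Two vertices of an edge determine the third one. -/
lemma IsEdge.vertex_unique {p q : G × G} {a u v v' : Option (Fin 3 × G)} (h : IsEdge p a u v)
    (h' : IsEdge q a u v') : v = v' := by
  rcases p with ⟨g, k⟩
  rcases q with ⟨g', k'⟩
  rcases h.cases with h | h | h | h | h | h <;> rcases h'.cases with h' | h' | h' | h' | h' | h' <;>
    obtain ⟨rfl, rfl, rfl⟩ := h <;> obtain ⟨h1, h2, rfl⟩ := h' <;> simp_all

variable [Fintype G]

/-- The cubic form `∑_{g+h+k=0} θ(g,h) y_{0,g} y_{1,h} y_{2,k}` with signs `θ` as coefficients,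
in three groups of variables indexed by a finite abelian group. -/
def cubicForm (θ : G × G → ℤˣ) (y : Fin 3 × G → ℤˣ) : ℝ :=
  ∑ p, ((θ p : ℤ) : ℝ) * ((edgeSign y p : ℤ) : ℝ)

lemma cubicForm_neg (θ : G × G → ℤˣ) (y : Fin 3 × G → ℤˣ) :
    cubicForm θ (-y) = -cubicForm θ y := by
  simp [cubicForm, edgeSign_neg]

variable [DecidableEq G]

lemma expect_edgeSign_eq_zero {p : G × G} {a u v : Option (Fin 3 × G)} (h : ¬ IsEdge p a u v) :
    𝔼 y, ((edgeSign y p : ℤ) : ℝ) * (signAt y a * signAt y u * signAt y v) = 0 := by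
  simp only [IsEdge, not_forall, not_or] at h
  obtain ⟨w, hw, ha, hu, hv⟩ := h
  refine expect_eq_zero_of_flipAt w fun y => ?_
  rw [signAt_flipAt_of_ne ha, signAt_flipAt_of_ne hu, signAt_flipAt_of_ne hv, ← neg_mul]
  congr 1
  rw [edgeSign_cast, edgeSign_cast]
  rcases hw with rfl | rfl | rfl
  · rw [signAt_flipAt_self, signAt_flipAt_of_ne (by simp), signAt_flipAt_of_ne (by simp)]
    ring
  · rw [signAt_flipAt_self, signAt_flipAt_of_ne (by simp), signAt_flipAt_of_ne (by simp)]
    ring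
  · rw [signAt_flipAt_self, signAt_flipAt_of_ne (by simp), signAt_flipAt_of_ne (by simp)]
    ring

/-- The Fourier coefficient `𝔼 p(y) y_a y_u y_v` of the cubic form. -/
noncomputable def cubicCoeff (θ : G × G → ℤˣ) (a u v : Option (Fin 3 × G)) : ℝ :=
  𝔼 y, cubicForm θ y * (signAt y a * signAt y u * signAt y v)

lemma cubicCoeff_eq_sum (θ : G × G → ℤˣ) (a u v : Option (Fin 3 × G)) :
    cubicCoeff θ a u v = ∑ p, ((θ p : ℤ) : ℝ) *
      𝔼 y, ((edgeSign y p : ℤ) : ℝ) * (signAt y a * signAt y u * signAt y v) := by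
  simp only [cubicCoeff, cubicForm, Finset.sum_mul, Finset.expect_sum_comm, Finset.mul_expect,
    mul_assoc]

lemma cubicCoeff_eq_zero (θ : G × G → ℤˣ) {a u v : Option (Fin 3 × G)}
    (h : ∀ p, ¬ IsEdge p a u v) : cubicCoeff θ a u v = 0 := by
  rw [cubicCoeff_eq_sum]
  exact Finset.sum_eq_zero fun p _ => by rw [expect_edgeSign_eq_zero (h p), mul_zero]

lemma cubicCoeff_of_isEdge (θ : G × G → ℤˣ) {p : G × G} {a u v : Option (Fin 3 × G)}
    (h : IsEdge p a u v) : cubicCoeff θ a u v = ((θ p : ℤ) : ℝ) := by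
  rw [cubicCoeff_eq_sum, Finset.sum_eq_single p]
  · have : ∀ y : Fin 3 × G → ℤˣ,
        ((edgeSign y p : ℤ) : ℝ) * (signAt y a * signAt y u * signAt y v) = 1 := by
      intro y
      have e0 := signAt_mul_self y (some (0, p.1))
      have e1 := signAt_mul_self y (some (1, p.2))
      have e2 := signAt_mul_self y (some (2, -(p.1 + p.2)))
      rw [edgeSign_cast]
      rcases h.cases with h | h | h | h | h | h <;> obtain ⟨rfl, rfl, rfl⟩ := h <;>
        linear_combination
          signAt y (some (1, p.2)) ^ 2 * signAt y (some (2, -(p.1 + p.2))) ^ 2 * e0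
          + signAt y (some (2, -(p.1 + p.2))) ^ 2 * e1 + e2
    simp [this]
  · intro q _ hq
    rw [expect_edgeSign_eq_zero fun h' => hq (h'.edge_unique h), mul_zero]
  · simp

lemma abs_cubicCoeff_le_one (θ : G × G → ℤˣ) (a u v : Option (Fin 3 × G)) :
    |cubicCoeff θ a u v| ≤ 1 := by
  by_cases h : ∃ p, IsEdge p a u v
  · obtain ⟨p, hp⟩ := h
    rw [cubicCoeff_of_isEdge θ hp]
    rcases Int.units_eq_one_or (θ p) with h | h <;> simp [h]
  · rw [cubicCoeff_eq_zero θ (not_exists.mp h)]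
    simp

lemma cubicCoeff_swap (θ : G × G → ℤˣ) (a u v : Option (Fin 3 × G)) :
    cubicCoeff θ a u v = cubicCoeff θ a v u := by
  simp only [cubicCoeff, mul_assoc, mul_comm (signAt _ u)]

lemma cubicCoeff_unique (θ : G × G → ℤˣ) {a u v v' : Option (Fin 3 × G)}
    (h : cubicCoeff θ a u v ≠ 0) (h' : cubicCoeff θ a u v' ≠ 0) : v = v' := by
  obtain ⟨p, hp⟩ : ∃ p, IsEdge p a u v := by
    by_contra! hc
    exact h (cubicCoeff_eq_zero θ hc)
  obtain ⟨q, hq⟩ : ∃ q, IsEdge q a u v' := by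
    by_contra! hc
    exact h' (cubicCoeff_eq_zero θ hc)
  exact hp.vertex_unique hq

/-- Parseval: all `|G|²` nonzero coefficients are signs. -/
lemma expect_cubicForm_sq (θ : G × G → ℤˣ) :
    𝔼 y, cubicForm θ y * cubicForm θ y = (Fintype.card G : ℝ) ^ 2 := by
  have h1 : ∀ y, cubicForm θ y * cubicForm θ y = ∑ p : G × G, ((θ p : ℤ) : ℝ) *
      (cubicForm θ y * (signAt y (some (0, p.1)) * signAt y (some (1, p.2)) *
        signAt y (some (2, -(p.1 + p.2))))) := by
    intro y
    conv_lhs => enter [1]; rw [cubicForm]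
    rw [Finset.sum_mul]
    refine Finset.sum_congr rfl fun p _ => ?_
    rw [edgeSign_cast]
    ring
  simp only [h1, Finset.expect_sum_comm, ← Finset.mul_expect]
  have h2 : ∀ p : G × G, ((θ p : ℤ) : ℝ) * cubicCoeff θ (some (0, p.1)) (some (1, p.2))
      (some (2, -(p.1 + p.2))) = 1 := by
    intro p
    rw [cubicCoeff_of_isEdge θ (isEdge_self p)]
    rcases Int.units_eq_one_or (θ p) with h | h <;> simp [h]
  simp only [cubicCoeff] at h2
  simp only [h2]
  simp [sq]

end CubicForm

/-! ### Varopoulos operators -/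

section Varopoulos

open scoped BigOperators

variable {G : Type*} [AddCommGroup G] [Fintype G] [DecidableEq G]

/-- The operators of Varopoulos attached to the cubic form with signs `θ`. They act on
`ℂ ⊕ ℂ^V ⊕ ℂ^V ⊕ ℂ`, `V` being the set of variables, and raise the level by one:
`X_v (α, ξ, η, β) = (0, α δ_v, c_v ξ, η_v)` with `c_v` the slice at `v` of the coefficient
tensor. The four summands have the index sets `inl none`, `inl (some _)`, `inr (some _)` and
`inr none`. The idle coordinate `none` acts as the identity. -/
noncomputable def varopoulosOp (θ : G × G → ℤˣ) :
    Option (Fin 3 × G) → Module.End ℂ (Option (Fin 3 × G) ⊕ Option (Fin 3 × G) → ℂ)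
  | none => LinearMap.id
  | some v =>
    { toFun := fun k => Sum.elim
        (fun i => i.elim 0 fun u => if u = v then k (Sum.inl none) else 0)
        (fun i => i.elim (k (Sum.inr (some v))) fun u =>
          ∑ u', (cubicCoeff θ (some v) (some u) (some u') : ℂ) * k (Sum.inl (some u')))
      map_add' := fun k l => by
        ext (i | i) <;> rcases i with _ | u <;>
          simp [mul_add, Finset.sum_add_distrib, ite_add_zero]
      map_smul' := fun t k => by
        ext (i | i) <;> rcases i with _ | u <;>
          simp [Finset.mul_sum, mul_left_comm] }

section

variable (θ : G × G → ℤˣ) (v u : Fin 3 × G) (k : Option (Fin 3 × G) ⊕ Option (Fin 3 × G) → ℂ)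

@[simp] lemma varopoulosOp_none : varopoulosOp θ none k = k := rfl

@[simp] lemma varopoulosOp_inl_none : varopoulosOp θ (some v) k (Sum.inl none) = 0 := rfl

@[simp] lemma varopoulosOp_inl_some : varopoulosOp θ (some v) k (Sum.inl (some u)) =
    if u = v then k (Sum.inl none) else 0 := rfl

@[simp] lemma varopoulosOp_inr_some : varopoulosOp θ (some v) k (Sum.inr (some u)) =
    ∑ u', (cubicCoeff θ (some v) (some u) (some u') : ℂ) * k (Sum.inl (some u')) := rfl

@[simp] lemma varopoulosOp_inr_none :
    varopoulosOp θ (some v) k (Sum.inr none) = k (Sum.inr (some v)) := rfl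

end

lemma isContraction_cubicCoeff (θ : G × G → ℤˣ) (v : Fin 3 × G) :
    IsContraction (Matrix.of fun u u' => (cubicCoeff θ (some v) (some u) (some u') : ℂ)) := by
  refine IsContraction.of_partialPerm (fun u u' => ?_) (fun u u' u'' h h' => ?_)
    fun u u' u'' h h' => ?_
  · rw [Complex.norm_real, Real.norm_eq_abs]
    exact abs_cubicCoeff_le_one θ _ _ _
  · exact Option.some_injective _
      (cubicCoeff_unique θ (Complex.ofReal_ne_zero.mp h) (Complex.ofReal_ne_zero.mp h'))
  · rw [cubicCoeff_swap] at h h'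
    exact Option.some_injective _
      (cubicCoeff_unique θ (Complex.ofReal_ne_zero.mp h) (Complex.ofReal_ne_zero.mp h'))

lemma sum_norm_varopoulosOp_le (θ : G × G → ℤˣ) (a : Option (Fin 3 × G))
    (k : Option (Fin 3 × G) ⊕ Option (Fin 3 × G) → ℂ) :
    ∑ i, ‖varopoulosOp θ a k i‖ ^ 2 ≤ ∑ i, ‖k i‖ ^ 2 := by
  rcases a with _ | v
  · simp
  · have h1 := isContraction_cubicCoeff θ v fun u => k (Sum.inl (some u))
    simp only [Matrix.mulVec, dotProduct, Matrix.of_apply] at h1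
    have h2 : ‖k (Sum.inr (some v))‖ ^ 2 ≤ ∑ u, ‖k (Sum.inr (some u))‖ ^ 2 :=
      Finset.single_le_sum (f := fun u => ‖k (Sum.inr (some u))‖ ^ 2)
        (fun _ _ => by positivity) (Finset.mem_univ v)
    have h3 : ∑ u, ‖if u = v then k (Sum.inl none) else 0‖ ^ 2 = ‖k (Sum.inl none)‖ ^ 2 := by
      rw [Finset.sum_eq_single v] <;> simp +contextual
    simp only [Fintype.sum_sum_type, Fintype.sum_option, varopoulosOp_inl_none,
      varopoulosOp_inl_some, varopoulosOp_inr_none, varopoulosOp_inr_some, h3, norm_zero]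
    nlinarith [sq_nonneg ‖k (Sum.inr none)‖]

lemma cubicCoeff_none (θ : G × G → ℤˣ) (u v : Option (Fin 3 × G)) :
    cubicCoeff θ none u v = 0 ∧ cubicCoeff θ u none v = 0 ∧ cubicCoeff θ u v none = 0 := by
  refine ⟨?_, ?_, ?_⟩ <;> refine cubicCoeff_eq_zero θ fun p h => ?_ <;> simpa using h.cases

lemma cubicCoeff_swap_left (θ : G × G → ℤˣ) (a u v : Option (Fin 3 × G)) :
    cubicCoeff θ a u v = cubicCoeff θ u a v := by
  simp only [cubicCoeff, mul_comm (signAt _ u)]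

/-- The matrix elements of fourfold products of the operators are the correlations of the
cubic form with the corresponding products of signs. -/
lemma varopoulosOp_matrixElement (θ : G × G → ℤˣ) (a b c d : Option (Fin 3 × G)) :
    varopoulosOp θ a (varopoulosOp θ b (varopoulosOp θ c (varopoulosOp θ d
      (Pi.single (Sum.inl none) 1)))) (Sum.inr none) =
      ((𝔼 y, cubicForm θ y * (signAt y a * signAt y b * signAt y c * signAt y d) : ℝ) : ℂ) := by
  -- If one coordinate is idle, the correlation is the coefficient at the other three, in the
  -- order in which the operators produce it.
  have ha : 𝔼 y, cubicForm θ y * (signAt y none * signAt y b * signAt y c * signAt y d) =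
    cubicCoeff θ c b d := by rw [cubicCoeff_swap_left]; simp [cubicCoeff]
  have hb : 𝔼 y, cubicForm θ y * (signAt y a * signAt y none * signAt y c * signAt y d) =
    cubicCoeff θ c a d := by rw [cubicCoeff_swap_left]; simp [cubicCoeff]
  have hc : 𝔼 y, cubicForm θ y * (signAt y a * signAt y b * signAt y none * signAt y d) =
    cubicCoeff θ b a d := by rw [cubicCoeff_swap_left]; simp [cubicCoeff]
  have hd : 𝔼 y, cubicForm θ y * (signAt y a * signAt y b * signAt y c * signAt y none) =
    cubicCoeff θ b a c := by rw [cubicCoeff_swap_left]; simp [cubicCoeff]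
  rcases a with _ | a
  · rw [ha]
    rcases b with _ | b <;> rcases c with _ | c <;> rcases d with _ | d <;>
      simp [cubicCoeff_none]
  rcases b with _ | b
  · rw [hb]
    rcases c with _ | c <;> rcases d with _ | d <;>
      simp [cubicCoeff_none]
  rcases c with _ | c
  · rw [hc]
    rcases d with _ | d <;>
      simp [cubicCoeff_none]
  rcases d with _ | d
  · rw [hd]
    simp
  -- Without idle coordinates, the operators leave the space and the correlation is odd in `y`.
  rw [expect_eq_zero_of_neg]
  · simp
  · intro y
    simp only [cubicForm_neg, signAt_neg_some]
    ring

end Varopoulos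

/-! ### The quartic polynomial -/

section Quartic

open scoped BigOperators

variable {G : Type*} [AddCommGroup G] [Fintype G] {n : ℕ}

/-- Embedding of the inputs of the cubic form into the cube of all variables: the extra variable
`none` is set to `1`. -/
def extendInput (e : Fin n ≃ Option (Fin 3 × G)) (y : Fin 3 × G → ℤˣ) (i : Fin n) : ℤˣ :=
  (e i).elim 1 y

/-- The quartic polynomial `t · w · p(y)`, where `p` is the cubic form with signs `θ` and `w` is
the extra variable. -/
noncomputable def quarticPoly (θ : G × G → ℤˣ) (e : Fin n ≃ Option (Fin 3 × G)) (t : ℝ) :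
    MvPolynomial (Fin n) ℝ :=
  ∑ p, MvPolynomial.C (t * ((θ p : ℤ) : ℝ)) * (MvPolynomial.X (e.symm none) *
    MvPolynomial.X (e.symm (some (0, p.1))) * MvPolynomial.X (e.symm (some (1, p.2))) *
    MvPolynomial.X (e.symm (some (2, -(p.1 + p.2)))))

lemma isHomogeneous_quarticPoly (θ : G × G → ℤˣ) (e : Fin n ≃ Option (Fin 3 × G)) (t : ℝ) :
    (quarticPoly θ e t).IsHomogeneous 4 := by
  refine MvPolynomial.IsHomogeneous.sum _ _ _ fun p _ => ?_
  exact (MvPolynomial.isHomogeneous_C _ _).mul ((((MvPolynomial.isHomogeneous_X _ _).mul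
    (MvPolynomial.isHomogeneous_X _ _)).mul (MvPolynomial.isHomogeneous_X _ _)).mul
    (MvPolynomial.isHomogeneous_X _ _))

lemma evalCube_quarticPoly (θ : G × G → ℤˣ) (e : Fin n ≃ Option (Fin 3 × G)) (t : ℝ)
    (x : Fin n → ℤˣ) : evalCube (quarticPoly θ e t) x =
      t * ((x (e.symm none) : ℤ) : ℝ) * cubicForm θ fun v => x (e.symm (some v)) := by
  simp only [evalCube, quarticPoly, map_sum, map_mul, MvPolynomial.eval_C, MvPolynomial.eval_X,
    cubicForm, edgeSign_cast, signAt_some, Finset.mul_sum]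
  refine Finset.sum_congr rfl fun p _ => ?_
  ring

lemma evalCube_quarticPoly_extendInput (θ : G × G → ℤˣ) (e : Fin n ≃ Option (Fin 3 × G)) (t : ℝ)
    (y : Fin 3 × G → ℤˣ) :
    evalCube (quarticPoly θ e t) (extendInput e y) = t * cubicForm θ y := by
  rw [evalCube_quarticPoly]
  simp [extendInput]

lemma isBoundedOnCube_quarticPoly {θ : G × G → ℤˣ} (e : Fin n ≃ Option (Fin 3 × G)) {t : ℝ}
    (ht : 0 < t) (hθ : ∀ y, |cubicForm θ y| ≤ t⁻¹) : IsBoundedOnCube (quarticPoly θ e t) := by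
  intro x
  rw [Set.mem_Icc, ← abs_le, evalCube_quarticPoly, abs_mul, abs_mul, abs_of_pos ht]
  have h1 : |((x (e.symm none) : ℤ) : ℝ)| = 1 := by
    rcases Int.units_eq_one_or (x (e.symm none)) with h | h <;> simp [h]
  rw [h1, mul_one]
  calc _ ≤ t * t⁻¹ := mul_le_mul_of_nonneg_left (hθ _) ht.le
    _ = 1 := mul_inv_cancel₀ ht.ne'

variable [DecidableEq G]

/-- A function on the cube that a two-query algorithm computes in expectation has correlation
at most `1` with the cubic form, after restriction to inputs with the extra variable set to `1`. -/
lemma expect_cubicForm_mul_expectation_le_one (θ : G × G → ℤˣ) (e : Fin n ≃ Option (Fin 3 × G))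
    (A : QueryAlgorithm n 2) :
    𝔼 y, cubicForm θ y * A.expectation (extendInput e y) ≤ 1 := by
  obtain ⟨φ, A₁, A₂, A₃, hφ, h₁, h₂, h₃, hA⟩ := A.exists_expectation_eq_fourForm
  set τ : QBasis n A.workDim → Option (Fin 3 × G) := fun b => b.1.bind e with hτ
  have hsign : ∀ y (b : QBasis n A.workDim),
      QueryAlgorithm.oracleSign (extendInput e y) b = (signAt y (τ b) : ℂ) := by
    rintro y ⟨_ | i, w⟩
    · simp [QueryAlgorithm.oracleSign, hτ]
    · rcases h : e i with _ | v <;>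
        simp [QueryAlgorithm.oracleSign, hτ, extendInput, h, signAt_some]
  have h1 : ∀ y, cubicForm θ y * A.expectation (extendInput e y) =
      (fourForm φ φ A₁ A₂ A₃ fun a b c d => ((cubicForm θ y * (signAt y (τ a) * signAt y (τ b) *
        signAt y (τ c) * signAt y (τ d)) : ℝ) : ℂ)).re := by
    intro y
    rw [hA, ofReal_mul_re_fourForm]
    simp only [hsign, Complex.ofReal_mul]
  simp only [h1]
  rw [expect_re_fourForm φ φ A₁ A₂ A₃ fun y a b c d => cubicForm θ y * (signAt y (τ a) *
    signAt y (τ b) * signAt y (τ c) * signAt y (τ d))]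
  simp only [← varopoulosOp_matrixElement]
  exact (Complex.re_le_norm _).trans (norm_fourForm_le_one hφ hφ h₁ h₂ h₃
    (fun b => varopoulosOp θ (τ b))
    (fun b v => sum_norm_varopoulosOp_le θ (τ b) v) _ _)

lemma quarticPoly_ne_zero [Nonempty G] (θ : G × G → ℤˣ) (e : Fin n ≃ Option (Fin 3 × G)) {t : ℝ}
    (ht : t ≠ 0) : quarticPoly θ e t ≠ 0 := by
  intro h
  have h0 : ∀ y, cubicForm θ y = 0 := fun y => by
    have := evalCube_quarticPoly_extendInput θ e t y
    rw [h] at this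
    simpa [evalCube, ht] using this
  have := expect_cubicForm_sq θ
  simp only [h0, mul_zero, Finset.expect_const_zero] at this
  exact pow_ne_zero 2 (Nat.cast_ne_zero.mpr Fintype.card_ne_zero) this.symm

/-- Random signs make the cubic form small on the cube, compared with its `|G|²` coefficients. -/
lemma exists_abs_cubicForm_le {ε : ℝ} (hε : 0 < ε) (hG : 6 / ε ^ 2 ≤ Fintype.card G) :
    ∃ θ : G × G → ℤˣ, ∀ y, |cubicForm θ y| ≤ ε * (Fintype.card G : ℝ) ^ 2 := by
  obtain ⟨θ, hθ⟩ := exists_signs_forall_sum_le hε fun y : Fin 3 × G → ℤˣ => edgeSign y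
  have hle : ∀ y, cubicForm θ y ≤ ε * (Fintype.card G : ℝ) ^ 2 := by
    intro y
    refine (hθ y).trans ?_
    have hlog : Real.log (Fintype.card (Fin 3 × G → ℤˣ)) ≤ 3 * Fintype.card G := by
      have : Fintype.card ℤˣ = 2 := rfl
      rw [Fintype.card_fun, this]
      push_cast
      rw [Real.log_pow, Fintype.card_prod, Fintype.card_fin]
      push_cast
      have := Real.log_two_lt_d9
      nlinarith [(Nat.cast_nonneg (Fintype.card G) : (0 : ℝ) ≤ _)]
    have h6 : 6 ≤ Fintype.card G * ε ^ 2 := (div_le_iff₀ (by positivity)).mp hG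
    have h1 : Real.log (Fintype.card (Fin 3 × G → ℤˣ)) / ε ≤
        ε / 2 * (Fintype.card G : ℝ) ^ 2 := by
      rw [div_le_iff₀ hε]
      nlinarith [(Nat.cast_nonneg (Fintype.card G) : (0 : ℝ) ≤ _)]
    rw [Fintype.card_prod]
    push_cast
    nlinarith
  refine ⟨θ, fun y => abs_le.mpr ⟨?_, hle y⟩⟩
  have := hle (-y)
  rw [cubicForm_neg] at this
  linarith

end Quartic

theorem mainTheorem2 (C : ℝ) (hC : 0 < C) :
    ∃ (n : ℕ) (f : MvPolynomial (Fin n) ℝ),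
      f.totalDegree = 4 ∧ IsBoundedOnCube f ∧
        ¬ ∃ A : QueryAlgorithm n 2, ∀ x : Fin n → ℤˣ, A.expectation x = C * evalCube f x := by
  -- The correlation with the cubic form would be `C / ε`, so any `ε < C` would do.
  set ε := C / 2 with hε
  have hε0 : 0 < ε := half_pos hC
  obtain ⟨N, hN⟩ := exists_nat_ge (6 / ε ^ 2)
  have hcard : Fintype.card (ZMod (N + 1)) = N + 1 := ZMod.card _
  obtain ⟨θ, hθ⟩ := exists_abs_cubicForm_le (G := ZMod (N + 1)) hε0
    (by rw [hcard]; push_cast; linarith)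
  rw [hcard] at hθ
  set t : ℝ := (ε * ((N + 1 : ℕ) : ℝ) ^ 2)⁻¹ with ht
  have ht0 : 0 < t := by positivity
  set e := (Fintype.equivFin (Option (Fin 3 × ZMod (N + 1)))).symm
  refine ⟨_, quarticPoly θ e t,
    (isHomogeneous_quarticPoly θ e t).totalDegree (quarticPoly_ne_zero θ e ht0.ne'),
    isBoundedOnCube_quarticPoly e ht0 (by simpa [ht] using hθ), ?_⟩
  rintro ⟨A, hA⟩
  have h1 := expect_cubicForm_mul_expectation_le_one θ e A
  have h2 : ∀ y, cubicForm θ y * A.expectation (extendInput e y) =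
      C * t * (cubicForm θ y * cubicForm θ y) := by
    intro y
    rw [hA, evalCube_quarticPoly_extendInput]
    ring
  simp only [h2, ← Finset.mul_expect, expect_cubicForm_sq, hcard] at h1
  have h3 : C * t * ((N + 1 : ℕ) : ℝ) ^ 2 = 2 := by
    rw [ht, hε]
    field_simp
  linarith
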